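/- **Setting.** For $p\in\mathbb R$ and $R_A,R_B\ge 0$, the single-battlefield General Lotto game with favoritism $\text{GL-F}(p,R_A,R_B)$ is the following simultaneous-move game. Player $i\in\{A,B\}$ chooses a probability distribution $F_i$ on $[0,\infty)$ with mean at most $R_i$; the payoffs are $U_A=\Pr_{x_A\sim F_A,\,x_B\sim F_B\text{ independent}}[x_A+p\ge x_B]$ and $U_B=1-U_A$. Let $\pi_A^*(p,R_A,R_B)$ denote player $A$'s payoff in a Nash equilibrium. Fix a per-unit cost $c_B\in(0,1)$ of player $B$ and a strategy $(p_A,R_A)$ of player $A$ with $p_A>0$ (pre-allocated resources) and $R_A>0$ (real-time resources; $R_A=M_A-c_Ap_A$ when player $A$ has monetary budget $M_A$ and per-unit cost $c_A$). If player $B$ has monetary budget $M_B\ge 0$ and pre-allocates $p_B\in[0,M_B/c_B]$, its payoff in the Stackelberg game is $$u_B(p_A,p_B)=1-\pi_A^*(p_A-p_B,\;R_A,\;M_B-c_Bp_B).$$ Put $R_B=M_B-c_Bp_B$, $f_A=R_A+\sqrt{R_A(R_A+2(p_A-p_B))}$, $f_B=\sqrt{R_B}$, $g_B=\sqrt{R_B+2(p_B-p_A)}$,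 and $$u_B^{1A}(p_A,p_B)=\frac{R_B}{2R_A}\Big(\frac{f_A}{p_A-p_B+f_A}\Big)^2,\qquad u_B^{1B}(p_A,p_B)=1-\frac{R_A}{2}\Big(\frac{f_B+g_B}{p_B-p_A+f_B(f_B+g_B)}\Big)^2,$$ $$\hat p_B=\frac{M_B}{c_B}-\frac{M_B-c_Bp_A}{2-c_B}.$$ **Statement.** There is exactly one number $$h=h(R_A,p_A)\in\Big(R_A+p_A,\;p_A+\frac{R_A+\sqrt{R_A(R_A+2p_A)}}{2}\Big)$$ (depending also on $c_B$, but not on $M_B$) such that $u_B^{1A}(p_A,0)=u_B^{1B}(p_A,\hat p_B)$ holds when $M_B/c_B=h$. For every $M_B\ge 0$, the game $\text{GL-F}(p_A-p_B,R_A,M_B-c_Bp_B)$ has a Nash equilibrium and a unique equilibrium payoff for each $p_B\in[0,M_B/c_B]$, so that $u_B(p_A,\cdot)$ is well defined on $[0,M_B/c_B]$, and $$\operatorname*{arg\,max}_{p_B\in[0,M_B/c_B]}u_B(p_A,p_B)=\begin{cases}\{0\}&\text{if } M_B/c_B<h,\\ \{\hat p_B\}&\text{if } M_B/c_B>h,\\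 \{0,\hat p_B\}&\text{if } M_B/c_B=h.\end{cases}$$ -/

import Mathlib

open MeasureTheory

noncomputable section

namespace GeneralLotto

/-- Mixed strategies in a single-battlefield General Lotto game with budget `R`: probability
measures on the nonnegative reals whose expected expenditure is at most `R`. -/
def strategies (R : ℝ) : Set (Measure ℝ) :=
  {F | IsProbabilityMeasure F ∧ F (Set.Iio 0) = 0 ∧
    ∫⁻ x, ENNReal.ofReal x ∂F ≤ ENNReal.ofReal R}

/-- Expected payoff to player A on one battlefield of unit value with favoritism `p` towards A
(`p` may be negative) when the players draw `x_A ∼ FA` and `x_B ∼ FB` independently: the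
probability that `x_A + p ≥ x_B`. -/
def payoffA (p : ℝ) (FA FB : Measure ℝ) : ℝ :=
  (FA.prod FB).real {z : ℝ × ℝ | z.2 ≤ z.1 + p}

/-- Expected payoff to player B; the game has constant sum `1`. -/
def payoffB (p : ℝ) (FA FB : Measure ℝ) : ℝ := 1 - payoffA p FA FB

/-- Nash equilibria of the single-battlefield General Lotto game with favoritism
`GL-F(p, RA, RB)`. -/
def IsNash (p RA RB : ℝ) (FA FB : Measure ℝ) : Prop :=
  FA ∈ strategies RA ∧ FB ∈ strategies RB ∧
    (∀ GA ∈ strategies RA, payoffA p GA FB ≤ payoffA p FA FB) ∧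
    (∀ GB ∈ strategies RB, payoffB p FA GB ≤ payoffB p FA FB)

/-- `v` is player A's payoff in some Nash equilibrium of `GL-F(p, RA, RB)`. -/
def IsEquilibriumPayoffA (p RA RB v : ℝ) : Prop :=
  ∃ FA FB : Measure ℝ, IsNash p RA RB FA FB ∧ payoffA p FA FB = v

/-- Player A's equilibrium payoff `π_A^*(p, RA, RB)` in `GL-F(p, RA, RB)`. It is the element of
the set of equilibrium payoffs whenever that set has exactly one element. -/
def eqPayoffA (p RA RB : ℝ) : ℝ := sSup {v | IsEquilibriumPayoffA p RA RB v}

/-- Player B's payoff `u_B(p_A, p_B)` in the Stackelberg game, where player A has pre-allocated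
`pA` and keeps the real-time budget `RA`, and player B, with monetary budget `MB` and per-unit
cost `cB`, pre-allocates `pB` and keeps the real-time budget `MB - cB * pB`. -/
def uB (RA MB cB pA pB : ℝ) : ℝ := 1 - eqPayoffA (pA - pB) RA (MB - cB * pB)

/-- Player B's best responses: the maximizers of `u_B(p_A, ·)` over `[0, MB / cB]`. -/
def bestResponseB (RA MB cB pA : ℝ) : Set ℝ :=
  {pB | pB ∈ Set.Icc 0 (MB / cB) ∧ IsMaxOn (uB RA MB cB pA) (Set.Icc 0 (MB / cB)) pB}

def fA (RA pA pB : ℝ) : ℝ := RA + √(RA * (RA + 2 * (pA - pB)))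

def fB (MB cB pB : ℝ) : ℝ := √(MB - cB * pB)

def gB (MB cB pA pB : ℝ) : ℝ := √(MB - cB * pB + 2 * (pB - pA))

/-- The closed-form expression `u_B^{1A}(p_A, p_B)`. -/
def uB1A (RA MB cB pA pB : ℝ) : ℝ :=
  (MB - cB * pB) / (2 * RA) * (fA RA pA pB / (pA - pB + fA RA pA pB)) ^ 2

/-- The closed-form expression `u_B^{1B}(p_A, p_B)`. -/
def uB1B (RA MB cB pA pB : ℝ) : ℝ :=
  1 - RA / 2 * ((fB MB cB pB + gB MB cB pA pB) /
    (pB - pA + fB MB cB pB * (fB MB cB pB + gB MB cB pA pB))) ^ 2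

/-- The candidate response `p̂_B`. -/
def pHatB (MB cB pA : ℝ) : ℝ := MB / cB - (MB - cB * pA) / (2 - cB)

/-- The open interval containing the threshold. -/
def thresholdInterval (RA pA : ℝ) : Set ℝ :=
  Set.Ioo (RA + pA) (pA + (RA + √(RA * (RA + 2 * pA))) / 2)

/-- `m` is a value of the ratio `MB / cB` in the threshold interval (so `MB = cB * m`) at which
`u_B^{1A}(p_A, 0) = u_B^{1B}(p_A, p̂_B)`. -/
def IsThreshold (RA cB pA m : ℝ) : Prop :=
  m ∈ thresholdInterval RA pA ∧
    uB1A RA (cB * m) cB pA 0 = uB1B RA (cB * m) cB pA (pHatB (cB * m) cB pA)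

end GeneralLotto

end

namespace GeneralLotto

/-! The game has constant sum, so its equilibrium payoff is unique. It is found from explicit saddle
points: each player mixes an atom at zero with a uniform law, the opponent's winning probability
then lies below an affine function of the bid, and the mean constraint turns this into a payoff
bound. The sign of the favoritism, and which player is too weak to bid all the time, give four
closed forms for `uB`.

Write r, a, x for R_A, p_A, p_B and m for M_B/c_B. For x ≤ a and B weak, the payoff is linear over
concave, hence quasiconvex in x, so only the ends of that range matter (`weakB_quasiconvex`). For x
> a and A weak, AM-GM gives the bound `payoffAtHat`, attained only at `pHatB` (`add_bidLength_lt`).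
When m ≥ r + a, the other regimes and the right end of the quasiconvex range do not beat `pHatB`;
when m < r + a, zero beats everything.

Thus 0 competes with `pHatB`, and the sign of `payoffGap`, a concave quadratic in m, decides. It is
negative at r + a and positive at a + L/2 and at (a + L/2)/c, where L = `bidLength r a`. Concavity
gives a single root h in the interval, with negative values before it and positive values up to (a +
L/2)/c. Beyond that point B is strong already at x = 0, and `strongB_lt_payoffAtHat` applies. -/

theorem measurableSet_win (p : ℝ) : MeasurableSet {z : ℝ × ℝ | z.2 ≤ z.1 + p} :=
  measurableSet_le measurable_snd (measurable_fst.add_const p)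

/-! ### Payoff bounds from affine majorants, and uniqueness of the value -/

theorem lintegral_affine_le {R a b : ℝ} (hR : 0 ≤ R) (ha : 0 ≤ a) (hb : 0 ≤ b) {F : Measure ℝ}
    (hF : F ∈ strategies R) {φ : ℝ → ENNReal}
    (hφ : ∀ x, 0 ≤ x → φ x ≤ ENNReal.ofReal (a + b * x)) :
    ∫⁻ x, φ x ∂F ≤ ENNReal.ofReal (a + b * R) := by
  obtain ⟨hP, h0, hm⟩ := hF
  have hae : ∀ᵐ x ∂F, φ x ≤ ENNReal.ofReal a + ENNReal.ofReal b * ENNReal.ofReal x := by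
    have : ∀ᵐ x ∂F, x ∉ Set.Iio (0 : ℝ) := measure_eq_zero_iff_ae_notMem.1 h0
    filter_upwards [this] with x hx
    have hx : 0 ≤ x := by simpa using hx
    rw [← ENNReal.ofReal_mul hb, ← ENNReal.ofReal_add ha (by positivity)]
    exact hφ x hx
  calc ∫⁻ x, φ x ∂F ≤ ∫⁻ x, (ENNReal.ofReal a + ENNReal.ofReal b * ENNReal.ofReal x) ∂F :=
        lintegral_mono_ae hae
    _ = ENNReal.ofReal a + ENNReal.ofReal b * ∫⁻ x, ENNReal.ofReal x ∂F := by
        rw [lintegral_add_left measurable_const, lintegral_const_mul _ (by fun_prop)]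
        simp
    _ ≤ ENNReal.ofReal a + ENNReal.ofReal b * ENNReal.ofReal R := by gcongr
    _ = _ := by rw [← ENNReal.ofReal_mul hb, ← ENNReal.ofReal_add ha (by positivity)]

theorem payoffA_le_of_cdf_le {p RA a b : ℝ} (hRA : 0 ≤ RA) (ha : 0 ≤ a) (hb : 0 ≤ b)
    {FA FB : Measure ℝ} [IsProbabilityMeasure FB] (hFA : FA ∈ strategies RA)
    (h : ∀ x, 0 ≤ x → FB (Set.Iic (x + p)) ≤ ENNReal.ofReal (a + b * x)) :
    payoffA p FA FB ≤ a + b * RA := by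
  have := hFA.1
  refine ENNReal.toReal_le_of_le_ofReal (by positivity) ?_
  rw [Measure.prod_apply (measurableSet_win p)]
  exact lintegral_affine_le hRA ha hb hFA h

theorem payoffB_eq (p : ℝ) (FA FB : Measure ℝ) [IsProbabilityMeasure FA]
    [IsProbabilityMeasure FB] :
    payoffB p FA FB = (∫⁻ y, FA (Set.Iio (y - p)) ∂FB).toReal := by
  rw [payoffB, payoffA, ← probReal_compl_eq_one_sub (measurableSet_win p), Measure.real,
    Measure.prod_apply_symm (measurableSet_win p).compl]
  congr 2
  ext y
  congr 1
  ext x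
  simp [lt_sub_iff_add_lt]

theorem payoffB_le_of_cdf_le {p RB a b : ℝ} (hRB : 0 ≤ RB) (ha : 0 ≤ a) (hb : 0 ≤ b)
    {FA FB : Measure ℝ} [IsProbabilityMeasure FA] (hFB : FB ∈ strategies RB)
    (h : ∀ y, 0 ≤ y → FA (Set.Iio (y - p)) ≤ ENNReal.ofReal (a + b * y)) :
    payoffB p FA FB ≤ a + b * RB := by
  have := hFB.1
  rw [payoffB_eq]
  exact ENNReal.toReal_le_of_le_ofReal (by positivity) (lintegral_affine_le hRB ha hb hFB h)

/-- Playing the two guarantees against each other forces the payoff to be exactly `v`, so only upper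
bounds ever have to be proved. -/
theorem isEquilibriumPayoffA_of_saddle {p RA RB v : ℝ} {FA FB : Measure ℝ}
    (hFA : FA ∈ strategies RA) (hFB : FB ∈ strategies RB)
    (hA : ∀ GA ∈ strategies RA, payoffA p GA FB ≤ v)
    (hB : ∀ GB ∈ strategies RB, payoffB p FA GB ≤ 1 - v) :
    IsEquilibriumPayoffA p RA RB v := by
  have h1 := hA FA hFA
  have h2 := hB FB hFB
  have hv : payoffA p FA FB = v := by
    unfold payoffB at h2
    linarith
  refine ⟨FA, FB, ⟨hFA, hFB, fun GA hGA => hv ▸ hA GA hGA, fun GB hGB => ?_⟩, hv⟩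
  rw [payoffB.eq_1 p FA FB, hv]
  exact hB GB hGB

theorem IsEquilibriumPayoffA.unique {p RA RB v w : ℝ} (hv : IsEquilibriumPayoffA p RA RB v)
    (hw : IsEquilibriumPayoffA p RA RB w) : v = w := by
  obtain ⟨FA, FB, ⟨hFA, hFB, h1, h2⟩, rfl⟩ := hv
  obtain ⟨GA, GB, ⟨hGA, hGB, h3, h4⟩, rfl⟩ := hw
  have h5 := h1 GA hGA
  have h6 := h2 GB hGB
  have h7 := h3 FA hFA
  have h8 := h4 FB hFB
  unfold payoffB at *
  linarith

theorem IsEquilibriumPayoffA.eqPayoffA_eq {p RA RB v : ℝ} (hv : IsEquilibriumPayoffA p RA RB v) :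
    eqPayoffA p RA RB = v := by
  have : {v | IsEquilibriumPayoffA p RA RB v} = {v} :=
    Set.eq_singleton_iff_unique_mem.2 ⟨hv, fun w hw => IsEquilibriumPayoffA.unique hw hv⟩
  rw [eqPayoffA, this, csSup_singleton]

/-! ### Mixtures of an atom and a uniform law -/

/-- The mixture of a point mass `1 - β` at `0` and a mass `β` spread uniformly on
`[c, c + L]`. -/
noncomputable def atomUniform (β c L : ℝ) : Measure ℝ :=
  ENNReal.ofReal (1 - β) • Measure.dirac 0 +
    ENNReal.ofReal β • (volume.restrict (Set.Icc (0 : ℝ) 1)).map (fun t => c + L * t)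

section atomUniform

variable {β c L : ℝ}

theorem measurable_affine (c L : ℝ) : Measurable fun t : ℝ => c + L * t := by fun_prop

theorem isProbabilityMeasure_atomUniform (h0 : 0 ≤ β) (h1 : β ≤ 1) :
    IsProbabilityMeasure (atomUniform β c L) := by
  constructor
  rw [atomUniform, Measure.add_apply, Measure.smul_apply, Measure.smul_apply,
    Measure.map_apply (measurable_affine c L) MeasurableSet.univ]
  simp [← ENNReal.ofReal_add (sub_nonneg.2 h1) h0]

theorem atomUniform_Iio_zero (hc : 0 ≤ c) (hL : 0 ≤ L) : atomUniform β c L (Set.Iio 0) = 0 := by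
  rw [atomUniform, Measure.add_apply, Measure.smul_apply, Measure.smul_apply,
    Measure.map_apply (measurable_affine c L) measurableSet_Iio,
    Measure.restrict_apply (measurable_affine c L measurableSet_Iio)]
  have : (fun t : ℝ => c + L * t) ⁻¹' Set.Iio 0 ∩ Set.Icc 0 1 = ∅ := by
    ext t
    simp only [Set.mem_inter_iff, Set.mem_preimage, Set.mem_Iio, Set.mem_Icc,
      Set.mem_empty_iff_false, iff_false, not_and]
    intro h h2
    have := mul_nonneg hL h2
    linarith
  simp [this]

theorem lintegral_atomUniform (h0 : 0 ≤ β) (hc : 0 ≤ c) (hL : 0 ≤ L) :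
    ∫⁻ x, ENNReal.ofReal x ∂(atomUniform β c L) = ENNReal.ofReal (β * (c + L / 2)) := by
  have hint : ∫⁻ t in Set.Icc (0 : ℝ) 1, ENNReal.ofReal (c + L * t)
      = ENNReal.ofReal (c + L / 2) := by
    rw [← ofReal_integral_eq_lintegral_ofReal]
    · congr 1
      rw [integral_Icc_eq_integral_Ioc, ← intervalIntegral.integral_of_le zero_le_one,
        intervalIntegral.integral_add (by simp) (by
          apply Continuous.intervalIntegrable; fun_prop),
        intervalIntegral.integral_const_mul, integral_id]
      simp
      ring
    · exact (by fun_prop : Continuous fun t : ℝ => c + L * t).continuousOn.integrableOn_Icc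
    · filter_upwards [ae_restrict_mem measurableSet_Icc] with t ht
      have := mul_nonneg hL ht.1
      simp only [Pi.zero_apply]
      linarith
  rw [atomUniform, lintegral_add_measure, lintegral_smul_measure, lintegral_smul_measure,
    lintegral_map (by fun_prop) (measurable_affine c L), hint]
  simp [ENNReal.ofReal_mul h0]

theorem atomUniform_mem_strategies {R : ℝ} (h0 : 0 ≤ β) (h1 : β ≤ 1) (hc : 0 ≤ c) (hL : 0 ≤ L)
    (hR : β * (c + L / 2) ≤ R) : atomUniform β c L ∈ strategies R := by
  refine ⟨isProbabilityMeasure_atomUniform h0 h1, atomUniform_Iio_zero hc hL, ?_⟩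
  rw [lintegral_atomUniform h0 hc hL]
  exact ENNReal.ofReal_le_ofReal hR

theorem atomUniform_Iic_le (h0 : 0 ≤ β) (h1 : β ≤ 1) (hL : 0 < L) {z : ℝ} (hz : c ≤ z) :
    atomUniform β c L (Set.Iic z) ≤ ENNReal.ofReal (1 - β + β * ((z - c) / L)) := by
  have hzc : 0 ≤ (z - c) / L := div_nonneg (sub_nonneg.2 hz) hL.le
  have hset : (fun t : ℝ => c + L * t) ⁻¹' Set.Iic z ∩ Set.Icc 0 1 ⊆ Set.Icc 0 ((z - c) / L) := by
    rintro t ⟨ht, ht0, -⟩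
    refine ⟨ht0, ?_⟩
    rw [le_div_iff₀ hL]
    simp only [Set.mem_preimage, Set.mem_Iic] at ht
    linarith
  rw [atomUniform, Measure.add_apply, Measure.smul_apply, Measure.smul_apply,
    Measure.map_apply (measurable_affine c L) measurableSet_Iic,
    Measure.restrict_apply (measurable_affine c L measurableSet_Iic),
    ENNReal.ofReal_add (sub_nonneg.2 h1) (mul_nonneg h0 hzc), ENNReal.ofReal_mul h0]
  have hv : volume ((fun t : ℝ => c + L * t) ⁻¹' Set.Iic z ∩ Set.Icc 0 1)
      ≤ ENNReal.ofReal ((z - c) / L) := by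
    refine (measure_mono hset).trans_eq ?_
    simp
  have hd : (Measure.dirac (0 : ℝ)) (Set.Iic z) ≤ 1 := prob_le_one
  simp only [smul_eq_mul]
  gcongr
  simpa using mul_le_mul_right hd (ENNReal.ofReal (1 - β))

theorem atomUniform_Iio_le (h0 : 0 ≤ β) (h1 : β ≤ 1) (hL : 0 < L) {z : ℝ} (hz : c ≤ z) :
    atomUniform β c L (Set.Iio z) ≤ ENNReal.ofReal (1 - β + β * ((z - c) / L)) :=
  (measure_mono Set.Iio_subset_Iic_self).trans (atomUniform_Iic_le h0 h1 hL hz)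

end atomUniform

/-! ### Saddle points and equilibrium payoffs in the four regimes -/

/-- Saddle points made of two mixtures of an atom at zero and a uniform distribution: for `0 ≤ p`
player B's uniform part starts at `p`. -/
theorem isEquilibriumPayoffA_of_favoritism_nonneg {p RA RB β γ L : ℝ} (hp : 0 ≤ p) (hL : 0 < L)
    (hRA : 0 ≤ RA) (hRB : 0 ≤ RB) (hβ0 : 0 ≤ β) (hβ1 : β ≤ 1) (hγ0 : 0 ≤ γ) (hγ1 : γ ≤ 1)
    (hA : γ * (L / 2) = RA) (hB : β * (p + L / 2) = RB)
    (hγ : γ * p ≤ (1 - γ) * L)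
    (hv : β * ((1 - γ) * L - γ * p) = (1 - γ) * L - γ * p) :
    IsEquilibriumPayoffA p RA RB (1 - β + β / L * RA) := by
  -- This is the intercept at y = 0 of the line majorizing A's shifted distribution function. By
  -- `hv` it vanishes unless β = 1: complementary slackness, which makes the two guarantees sum to
  -- 1.
  have h0 : 0 ≤ 1 - γ - γ * p / L := by
    rw [sub_nonneg, div_le_iff₀ hL]; exact hγ
  have := isProbabilityMeasure_atomUniform (c := p) (L := L) hβ0 hβ1
  have := isProbabilityMeasure_atomUniform (c := 0) (L := L) hγ0 hγ1
  refine isEquilibriumPayoffA_of_saddle (FA := atomUniform γ 0 L) (FB := atomUniform β p L)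
    (atomUniform_mem_strategies hγ0 hγ1 le_rfl hL.le (by simpa using hA.le))
    (atomUniform_mem_strategies hβ0 hβ1 hp hL.le hB.le) (fun GA hGA => ?_) (fun GB hGB => ?_)
  · refine payoffA_le_of_cdf_le hRA (by linarith) (by positivity) hGA fun x hx => ?_
    refine (atomUniform_Iic_le hβ0 hβ1 hL (by linarith)).trans_eq ?_
    congr 1
    field_simp
    ring
  · refine (payoffB_le_of_cdf_le (a := 1 - γ - γ * p / L) (b := γ / L) hRB h0 (by positivity)
      hGB fun y hy => ?_).trans_eq ?_
    -- A bid of at most `p` never wins for B, since ties go to A.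
    · rcases le_total y p with hyp | hyp
      · have : Set.Iio (y - p) ⊆ Set.Iio 0 := Set.Iio_subset_Iio (by linarith)
        rw [measure_mono_null this (atomUniform_Iio_zero le_rfl hL.le)]
        exact zero_le
      · refine (atomUniform_Iio_le hγ0 hγ1 hL (by linarith)).trans_eq ?_
        congr 1
        field_simp
        ring
    · rw [← hA, ← hB]
      field_simp
      linear_combination -2 * hv

/-- Saddle points made of two mixtures of an atom at zero and a uniform distribution: with
favoritism `q` towards player B, player A's uniform part starts at `q`. -/
theorem isEquilibriumPayoffA_of_favoritism_neg {q RA RB β γ L : ℝ} (hq : 0 < q) (hL : 0 < L)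
    (hRA : 0 ≤ RA) (hRB : 0 ≤ RB) (hβ0 : 0 ≤ β) (hβ1 : β ≤ 1) (hγ0 : 0 ≤ γ) (hγ1 : γ ≤ 1)
    (hA : β * (q + L / 2) = RA) (hB : γ * (L / 2) = RB)
    (hγ : γ * q ≤ (1 - γ) * L)
    (hv : β * ((1 - γ) * L - γ * q) = (1 - γ) * L - γ * q) :
    IsEquilibriumPayoffA (-q) RA RB (β - β / L * RB) := by
  have h0 : 0 ≤ 1 - γ - γ * q / L := by
    rw [sub_nonneg, div_le_iff₀ hL]; exact hγ
  have := isProbabilityMeasure_atomUniform (c := q) (L := L) hβ0 hβ1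
  have := isProbabilityMeasure_atomUniform (c := 0) (L := L) hγ0 hγ1
  refine isEquilibriumPayoffA_of_saddle (FA := atomUniform β q L) (FB := atomUniform γ 0 L)
    (atomUniform_mem_strategies hβ0 hβ1 hq.le hL.le hA.le)
    (atomUniform_mem_strategies hγ0 hγ1 le_rfl hL.le (by simpa using hB.le))
    (fun GA hGA => ?_) (fun GB hGB => ?_)
  · refine (payoffA_le_of_cdf_le (a := 1 - γ - γ * q / L) (b := γ / L) hRA h0 (by positivity)
      hGA fun x hx => ?_).trans_eq ?_
    · rcases lt_or_ge x q with hxq | hxq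
      · have : Set.Iic (x + -q) ⊆ Set.Iio 0 := Set.Iic_subset_Iio.2 (by linarith)
        rw [measure_mono_null this (atomUniform_Iio_zero le_rfl hL.le)]
        exact zero_le
      · refine (atomUniform_Iic_le hγ0 hγ1 hL (by linarith)).trans_eq ?_
        congr 1
        field_simp
        ring
    · rw [← hA, ← hB]
      field_simp
      linear_combination -2 * hv
  · refine (payoffB_le_of_cdf_le (a := 1 - β) (b := β / L) hRB (by linarith) (by positivity) hGB
      fun y hy => ?_).trans_eq (by ring)
    refine (atomUniform_Iio_le hβ0 hβ1 hL (by linarith)).trans_eq ?_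
    congr 1
    field_simp
    ring

/-- If player B has no real-time budget, player A's best is to match B's favoritism as often as
possible. -/
theorem isEquilibriumPayoffA_of_budget_eq_zero {q RA : ℝ} (hq : 0 < q) (hRA : 0 ≤ RA)
    (hRAq : RA ≤ q) : IsEquilibriumPayoffA (-q) RA 0 (RA / q) := by
  have hβ0 : 0 ≤ RA / q := by positivity
  have hβ1 : RA / q ≤ 1 := (div_le_one hq).2 hRAq
  have := isProbabilityMeasure_atomUniform (c := q) (L := 0) hβ0 hβ1
  refine isEquilibriumPayoffA_of_saddle (FA := atomUniform (RA / q) q 0) (FB := Measure.dirac 0)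
    (atomUniform_mem_strategies hβ0 hβ1 hq.le le_rfl (by field_simp; simp [mul_assoc]))
    ⟨inferInstance, by simp, by simp⟩ (fun GA hGA => ?_) (fun GB hGB => ?_)
  · refine (payoffA_le_of_cdf_le (a := 0) (b := 1 / q) hRA le_rfl (by positivity)
      hGA fun x hx => ?_).trans_eq (by ring)
    rcases lt_or_ge x q with hxq | hxq
    · simp [hxq]
    · refine prob_le_one.trans ?_
      rw [← ENNReal.ofReal_one]
      refine ENNReal.ofReal_le_ofReal ?_
      rw [zero_add, one_div_mul_eq_div, le_div_iff₀ hq]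
      linarith
  · have := hGB.1
    have hlt : atomUniform (RA / q) q 0 (Set.Iio q) ≤ ENNReal.ofReal (1 - RA / q) := by
      rw [atomUniform, Measure.add_apply, Measure.smul_apply, Measure.smul_apply,
        Measure.map_apply (measurable_affine q 0) measurableSet_Iio]
      simp [hq]
    have hae : ∀ᵐ y ∂GB, atomUniform (RA / q) q 0 (Set.Iio (y - -q))
        ≤ ENNReal.ofReal (1 - RA / q) := by
      have h0 : ∫⁻ x, ENNReal.ofReal x ∂GB = 0 := by
        simpa using hGB.2.2
      rw [lintegral_eq_zero_iff (by fun_prop)] at h0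
      filter_upwards [h0] with y hy
      have hy : y ≤ 0 := by simpa using hy
      exact (measure_mono (Set.Iio_subset_Iio (by linarith))).trans hlt
    rw [payoffB_eq]
    refine ENNReal.toReal_le_of_le_ofReal (by linarith) ?_
    calc _ ≤ ∫⁻ _, ENNReal.ofReal (1 - RA / q) ∂GB := lintegral_mono_ae hae
      _ = _ := by simp

/-- The length of the support of the equilibrium bids in the symmetric situation: the positive
solution `L` of `L ^ 2 = 2 * R * (L + p)`. -/
noncomputable def bidLength (R p : ℝ) : ℝ := R + √(R * (R + 2 * p))

theorem bidLength_sq {R p : ℝ} (hR : 0 ≤ R) (hp : 0 ≤ p) :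
    bidLength R p ^ 2 = 2 * R * (bidLength R p + p) := by
  have := Real.sq_sqrt (show 0 ≤ R * (R + 2 * p) by positivity)
  unfold bidLength
  linear_combination this

theorem two_mul_le_bidLength {R p : ℝ} (hR : 0 ≤ R) (hp : 0 ≤ p) : 2 * R ≤ bidLength R p := by
  have : R ≤ √(R * (R + 2 * p)) := Real.le_sqrt_of_sq_le (by nlinarith [mul_nonneg hR hp])
  unfold bidLength
  linarith

/-- If `L` is longer than the symmetric length, the quadratic is nonnegative. -/
theorem le_sq_of_bidLength_le {R p L : ℝ} (hR : 0 ≤ R) (hp : 0 ≤ p) (hL : bidLength R p ≤ L) :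
    2 * R * (L + p) ≤ L ^ 2 := by
  have h1 := bidLength_sq hR hp
  have h2 := two_mul_le_bidLength hR hp
  nlinarith [mul_nonneg (sub_nonneg.2 hL) (show 0 ≤ L + bidLength R p - 2 * R by linarith)]

/-- Here β ≤ 1 may be strict, so the intercept must vanish. This forces γ = L/(p + L), and A's
budget then becomes the quadratic equation that defines `bidLength`. -/
theorem isEquilibriumPayoffA_weakB {p RA RB : ℝ} (hp : 0 ≤ p) (hRA : 0 < RA) (hRB : 0 ≤ RB)
    (h : RB ≤ p + bidLength RA p / 2) :
    IsEquilibriumPayoffA p RA RB (1 - RB / (p + bidLength RA p)) := by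
  have hsq := bidLength_sq hRA.le hp
  have h2 := two_mul_le_bidLength hRA.le hp
  set L := bidLength RA p
  have hL : 0 < L := by linarith
  have hpL : 0 < p + L := by linarith
  have hpL2 : 0 < p + L / 2 := by linarith
  convert isEquilibriumPayoffA_of_favoritism_nonneg (β := RB / (p + L / 2)) (γ := L / (p + L))
    hp hL hRA.le hRB (by positivity) ((div_le_one hpL2).2 h) (by positivity)
    ((div_le_one hpL).2 (by linarith)) (by field_simp; linarith) (by field_simp)
    (by field_simp; ring_nf; exact le_rfl) (by field_simp; ring) using 1
  field_simp
  linear_combination RB * hsq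

/-- With β = 1 the budgets alone determine L and γ; `le_sq_of_bidLength_le` keeps the intercept
nonnegative. -/
theorem isEquilibriumPayoffA_strongB {p RA RB : ℝ} (hp : 0 ≤ p) (hRA : 0 < RA)
    (h : p + bidLength RA p / 2 ≤ RB) :
    IsEquilibriumPayoffA p RA RB (RA / (2 * (RB - p))) := by
  have h2 := two_mul_le_bidLength hRA.le hp
  have hsq := le_sq_of_bidLength_le hRA.le hp (L := 2 * (RB - p)) (by linarith)
  have hL : 0 < RB - p := by linarith
  convert isEquilibriumPayoffA_of_favoritism_nonneg (β := 1) (γ := RA / (RB - p))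
    (L := 2 * (RB - p)) hp (by linarith) hRA.le (by linarith) zero_le_one le_rfl (by positivity)
    ((div_le_one hL).2 (by linarith)) (by field_simp) (by ring)
    (by field_simp; nlinarith) (by ring) using 1
  field_simp
  ring

theorem isEquilibriumPayoffA_weakA {q RA RB : ℝ} (hq : 0 < q) (hRA : 0 < RA) (hRB : 0 ≤ RB)
    (h : RA ≤ q + bidLength RB q / 2) :
    IsEquilibriumPayoffA (-q) RA RB (RA / (q + bidLength RB q)) := by
  -- At `RB = 0` the bid interval collapses to a point, so the saddle point is a different one.
  rcases hRB.eq_or_lt with rfl | hRB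
  · have : bidLength 0 q = 0 := by simp [bidLength]
    rw [this] at h ⊢
    simpa using isEquilibriumPayoffA_of_budget_eq_zero hq hRA.le (by linarith)
  have hsq := bidLength_sq hRB.le hq.le
  have h2 := two_mul_le_bidLength hRB.le hq.le
  set L := bidLength RB q
  have hL : 0 < L := by linarith
  have hpL : 0 < q + L := by linarith
  have hpL2 : 0 < q + L / 2 := by linarith
  convert isEquilibriumPayoffA_of_favoritism_neg (β := RA / (q + L / 2)) (γ := L / (q + L))
    hq hL hRA.le hRB.le (by positivity) ((div_le_one hpL2).2 h) (by positivity)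
    ((div_le_one hpL).2 (by linarith)) (by field_simp) (by field_simp; linarith)
    (by field_simp; ring_nf; exact le_rfl) (by field_simp; ring) using 1
  field_simp
  linear_combination (-1) * hsq

theorem isEquilibriumPayoffA_strongA {q RA RB : ℝ} (hq : 0 < q) (hRB : 0 ≤ RB)
    (h : q + bidLength RB q / 2 < RA) :
    IsEquilibriumPayoffA (-q) RA RB (1 - RB / (2 * (RA - q))) := by
  have h2 := two_mul_le_bidLength hRB hq.le
  have hsq := le_sq_of_bidLength_le hRB hq.le (L := 2 * (RA - q)) (by linarith)
  have hL : 0 < RA - q := by linarith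
  convert isEquilibriumPayoffA_of_favoritism_neg (β := 1) (γ := RB / (RA - q))
    (L := 2 * (RA - q)) hq (by linarith) (by linarith) hRB zero_le_one le_rfl (by positivity)
    ((div_le_one hL).2 (by linarith)) (by ring) (by field_simp)
    (by field_simp; nlinarith) (by ring) using 1
  field_simp

theorem existsUnique_isEquilibriumPayoffA (p : ℝ) {RA RB : ℝ} (hRA : 0 < RA) (hRB : 0 ≤ RB) :
    ∃! v : ℝ, IsEquilibriumPayoffA p RA RB v := by
  suffices ∃ v, IsEquilibriumPayoffA p RA RB v from
    this.imp fun v hv => ⟨hv, fun w hw => IsEquilibriumPayoffA.unique hw hv⟩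
  rcases le_or_gt 0 p with hp | hp
  · rcases le_total RB (p + bidLength RA p / 2) with h | h
    · exact ⟨_, isEquilibriumPayoffA_weakB hp hRA hRB h⟩
    · exact ⟨_, isEquilibriumPayoffA_strongB hp hRA h⟩
  · obtain ⟨q, rfl⟩ : ∃ q, p = -q := ⟨-p, by ring⟩
    have hq : 0 < q := by linarith
    rcases le_or_gt RA (q + bidLength RB q / 2) with h | h
    · exact ⟨_, isEquilibriumPayoffA_weakA hq hRA hRB h⟩
    · exact ⟨_, isEquilibriumPayoffA_strongA hq hRB h⟩

/-! ### Closed forms of `uB`, with c, r, a, m, x for c_B, R_A, p_A, M_B/c_B, p_B -/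

section values

variable {c r a m x : ℝ}

theorem uB_of_weakB (hr : 0 < r) (hc : 0 < c) (hxa : x ≤ a) (hxm : x ≤ m)
    (h : c * (m - x) ≤ a - x + bidLength r (a - x) / 2) :
    uB r (c * m) c a x = c * (m - x) / (a - x + bidLength r (a - x)) := by
  have hRB : 0 ≤ c * (m - x) := mul_nonneg hc.le (sub_nonneg.2 hxm)
  rw [uB, ← mul_sub, (isEquilibriumPayoffA_weakB (sub_nonneg.2 hxa) hr hRB h).eqPayoffA_eq]
  ring

theorem uB_of_strongB (hr : 0 < r) (hxa : x ≤ a)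
    (h : a - x + bidLength r (a - x) / 2 ≤ c * (m - x)) :
    uB r (c * m) c a x = 1 - r / (2 * (c * (m - x) - (a - x))) := by
  rw [uB, ← mul_sub, (isEquilibriumPayoffA_strongB (sub_nonneg.2 hxa) hr h).eqPayoffA_eq]

theorem uB_of_weakA (hr : 0 < r) (hc : 0 < c) (hax : a < x) (hxm : x ≤ m)
    (h : r ≤ x - a + bidLength (c * (m - x)) (x - a) / 2) :
    uB r (c * m) c a x = 1 - r / (x - a + bidLength (c * (m - x)) (x - a)) := by
  have hRB : 0 ≤ c * (m - x) := mul_nonneg hc.le (sub_nonneg.2 hxm)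
  have := (isEquilibriumPayoffA_weakA (sub_pos.2 hax) hr hRB h).eqPayoffA_eq
  rw [neg_sub] at this
  rw [uB, ← mul_sub, this]

theorem uB_of_strongA (hc : 0 < c) (hax : a < x) (hxm : x ≤ m)
    (h : x - a + bidLength (c * (m - x)) (x - a) / 2 < r) :
    uB r (c * m) c a x = c * (m - x) / (2 * (r - (x - a))) := by
  have hRB : 0 ≤ c * (m - x) := mul_nonneg hc.le (sub_nonneg.2 hxm)
  have := (isEquilibriumPayoffA_strongA (sub_pos.2 hax) hRB h).eqPayoffA_eq
  rw [neg_sub] at this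
  rw [uB, ← mul_sub, this]
  ring

end values

/-! ### The two candidate payoffs and the sign of their gap -/

/-- Player B's payoff at zero pre-allocation when its real-time budget is moderate. -/
noncomputable def payoffAtZero (c r a m : ℝ) : ℝ := c * m / (a + bidLength r a)

/-- Player B's payoff at the interior candidate `pHatB`. -/
noncomputable def payoffAtHat (c r a m : ℝ) : ℝ := 1 - r * (2 - c) / (2 * (m - a))

/-- The sign of this concave quadratic in `m` compares the two candidate payoffs. -/
noncomputable def payoffGap (c r a m : ℝ) : ℝ :=
  m - a - r * (2 - c) / 2 - c * m * (m - a) / (a + bidLength r a)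

section algebra

variable {c r a m x : ℝ}

theorem lt_bidLength (hr : 0 < r) (ha : 0 < a) : 2 * r < bidLength r a := by
  have : r < √(r * (r + 2 * a)) := Real.lt_sqrt_of_sq_lt (by nlinarith [mul_pos hr ha])
  unfold bidLength
  linarith

theorem bidLength_lt (hr : 0 < r) (ha : 0 < a) : bidLength r a < 2 * r + a := by
  have : √(r * (r + 2 * a)) < r + a := by
    rw [Real.sqrt_lt' (by linarith)]
    nlinarith [mul_pos ha ha]
  unfold bidLength
  linarith

theorem bidLength_mono (hr : 0 ≤ r) {p p' : ℝ} (h : p ≤ p') : bidLength r p ≤ bidLength r p' := by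
  unfold bidLength
  gcongr

theorem payoffAtHat_sub_payoffAtZero (hr : 0 < r) (ha : 0 < a) (hm : a < m) :
    payoffAtHat c r a m - payoffAtZero c r a m = payoffGap c r a m / (m - a) := by
  have h1 := lt_bidLength hr ha
  have h2 : 0 < m - a := sub_pos.2 hm
  have h3 : 0 < a + bidLength r a := by linarith
  unfold payoffAtHat payoffAtZero payoffGap
  field_simp

/-- Concavity as an identity: a quadratic differs from its chord by its leading coefficient, here
-c/(a + L), times the node product. -/
theorem payoffGap_three_points (c r a x y z : ℝ) :
    (z - x) * payoffGap c r a y = (z - y) * payoffGap c r a x + (y - x) * payoffGap c r a z +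
      c / (a + bidLength r a) * ((z - y) * (y - x) * (z - x)) := by
  unfold payoffGap
  ring

theorem payoffGap_left_neg (hc : 0 < c) (hr : 0 < r) (ha : 0 < a) :
    payoffGap c r a (r + a) < 0 := by
  have h1 := lt_bidLength hr ha
  have h2 := bidLength_lt hr ha
  have h3 : 0 < a + bidLength r a := by linarith
  have : payoffGap c r a (r + a)
      = -(c * r * (2 * r + a - bidLength r a) / (2 * (a + bidLength r a))) := by
    unfold payoffGap
    field_simp
    ring
  rw [this, neg_lt_zero]
  have := sub_pos.2 h2
  positivity

theorem payoffGap_right_pos (hc : c < 1) (hr : 0 < r) (ha : 0 < a) :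
    0 < payoffGap c r a (a + bidLength r a / 2) := by
  have h1 := lt_bidLength hr ha
  have hsq := bidLength_sq hr.le ha.le
  have h3 : 0 < a + bidLength r a := by linarith
  have : payoffGap c r a (a + bidLength r a / 2) = (1 - c) * (bidLength r a / 2 - r) := by
    unfold payoffGap
    field_simp
    linear_combination c * hsq
  rw [this]
  exact mul_pos (by linarith) (by linarith)

/-- The evaluation point is the ratio m at which B ceases to be weak at zero pre-allocation. -/
theorem payoffGap_far_pos (hc0 : 0 < c) (hc : c < 1) (hr : 0 < r) (ha : 0 < a) :
    0 < payoffGap c r a ((a + bidLength r a / 2) / c) := by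
  have h1 := lt_bidLength hr ha
  have hsq := bidLength_sq hr.le ha.le
  set L := bidLength r a with hL
  have h3 : 0 < a + L := by linarith
  have hL0 : 0 < L := by linarith
  set y := (a + L / 2) / c - a with hy
  have hcy : c * y = (1 - c) * a + L / 2 := by rw [hy]; field_simp; ring
  have hyL : 0 < 2 * y - (2 - c) * L := by
    have : 0 < c * (2 * y - (2 - c) * L) := by
      have : c * (2 * y - (2 - c) * L) = 2 * ((1 - c) * a) + (1 - c) ^ 2 * L := by
        linear_combination 2 * hcy
      rw [this]
      have : 0 < 1 - c := by linarith
      positivity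
    exact pos_of_mul_pos_right this hc0.le
  have : payoffGap c r a ((a + L / 2) / c) = r * (2 * y - (2 - c) * L) / (2 * L) := by
    have e : c * ((a + L / 2) / c) = a + L / 2 := by field_simp
    unfold payoffGap
    rw [← hL, e, ← hy]
    field_simp
    linear_combination y * hsq
  rw [this]
  positivity

theorem payoffGap_neg_of_lt {h : ℝ} (hc0 : 0 < c) (hc : c < 1) (hr : 0 < r) (ha : 0 < a)
    (hh : payoffGap c r a h = 0) (hh2 : h < a + bidLength r a / 2) (hm : m < h) :
    payoffGap c r a m < 0 := by
  have h1 := payoffGap_three_points c r a m h (a + bidLength r a / 2)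
  have h2 := payoffGap_right_pos hc hr ha
  have h4 := lt_bidLength hr ha
  set R := a + bidLength r a / 2
  have h5 : 0 < c / (a + bidLength r a) * ((R - h) * (h - m) * (R - m)) := by
    have := sub_pos.2 hh2
    have := sub_pos.2 hm
    have : 0 < R - m := by linarith
    have : 0 < a + bidLength r a := by linarith
    positivity
  have h6 := mul_pos (sub_pos.2 hm) h2
  rw [hh] at h1
  by_contra! h7
  have := mul_nonneg (sub_nonneg.2 hh2.le) h7
  linarith

theorem payoffGap_pos_of_lt {h : ℝ} (hc0 : 0 < c) (hc : c < 1) (hr : 0 < r) (ha : 0 < a)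
    (hh : payoffGap c r a h = 0) (hm : h < m) (hm2 : c * m ≤ a + bidLength r a / 2) :
    0 < payoffGap c r a m := by
  have h1 := payoffGap_three_points c r a h m ((a + bidLength r a / 2) / c)
  have h2 := payoffGap_far_pos hc0 hc hr ha
  have h4 := lt_bidLength hr ha
  have h3 : m ≤ (a + bidLength r a / 2) / c := by rw [le_div_iff₀ hc0]; linarith
  set R := (a + bidLength r a / 2) / c
  have h5 : 0 ≤ c / (a + bidLength r a) * ((R - m) * (m - h) * (R - h)) := by
    have := sub_nonneg.2 h3
    have := sub_pos.2 hm
    have : 0 < R - h := by linarith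
    have : 0 < a + bidLength r a := by linarith
    positivity
  have h6 := mul_pos (sub_pos.2 hm) h2
  rw [hh] at h1
  exact pos_of_mul_pos_right (show 0 < (R - h) * payoffGap c r a m by linarith) (by linarith)

theorem exists_payoffGap_eq_zero (hc0 : 0 < c) (hc : c < 1) (hr : 0 < r) (ha : 0 < a) :
    ∃ h ∈ Set.Ioo (r + a) (a + bidLength r a / 2), payoffGap c r a h = 0 := by
  have hcont : ContinuousOn (payoffGap c r a) (Set.Icc (r + a) (a + bidLength r a / 2)) := by
    unfold payoffGap
    fun_prop
  have h4 := lt_bidLength hr ha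
  obtain ⟨h, hmem, hh⟩ := intermediate_value_Ioo (by linarith) hcont
    ⟨payoffGap_left_neg hc0 hr ha, payoffGap_right_pos hc hr ha⟩
  exact ⟨h, hmem, hh⟩

theorem uB1A_zero (hr : 0 < r) (ha : 0 < a) : uB1A r (c * m) c a 0 = payoffAtZero c r a m := by
  have h1 := lt_bidLength hr ha
  have hsq := bidLength_sq hr.le ha.le
  have hfA : fA r a 0 = bidLength r a := by simp [fA, bidLength]
  have h3 : 0 < a + bidLength r a := by linarith
  rw [uB1A, hfA, payoffAtZero, sub_zero, div_pow, hsq]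
  field_simp
  ring

theorem pHatB_eq (hc0 : 0 < c) : pHatB (c * m) c a = m - c * (m - a) / (2 - c) := by
  unfold pHatB
  field_simp

/-- In terms of k all radicands at `pHatB` become perfect squares, for instance M_B - c_B p_B =
(ck)². -/
theorem sqrt_hat (hc0 : 0 < c) (hc : c < 1) (ha : a < m) :
    ∃ k, 0 < k ∧ m - a = (2 - c) * k ^ 2 := by
  have h : 0 < (m - a) / (2 - c) := div_pos (by linarith) (by linarith)
  refine ⟨√((m - a) / (2 - c)), Real.sqrt_pos.2 h, ?_⟩
  rw [Real.sq_sqrt h.le]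
  have : 2 - c ≠ 0 := by linarith
  field_simp

theorem uB1B_pHatB (hc0 : 0 < c) (hc : c < 1) (hm : a < m) :
    uB1B r (c * m) c a (pHatB (c * m) c a) = payoffAtHat c r a m := by
  obtain ⟨k, hk, hmk⟩ := sqrt_hat hc0 hc hm
  have h2c : 0 < 2 - c := by linarith
  have hp : pHatB (c * m) c a = m - c * k ^ 2 := by
    rw [pHatB_eq hc0, hmk]
    field_simp
  have hf : fB (c * m) c (m - c * k ^ 2) = c * k := by
    rw [fB, show c * m - c * (m - c * k ^ 2) = (c * k) ^ 2 by ring, Real.sqrt_sq (by positivity)]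
  have hg : gB (c * m) c a (m - c * k ^ 2) = (2 - c) * k := by
    rw [gB, show c * m - c * (m - c * k ^ 2) + 2 * (m - c * k ^ 2 - a) = ((2 - c) * k) ^ 2 by
      linear_combination 2 * hmk, Real.sqrt_sq (by positivity)]
  rw [uB1B, hp, hf, hg, payoffAtHat, hmk,
    show m - c * k ^ 2 - a + c * k * (c * k + (2 - c) * k) = 2 * k ^ 2 by
      linear_combination hmk]
  field_simp
  ring

theorem isThreshold_iff (hc0 : 0 < c) (hc : c < 1) (hr : 0 < r) (ha : 0 < a) :
    IsThreshold r c a m ↔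
      m ∈ Set.Ioo (r + a) (a + bidLength r a / 2) ∧ payoffGap c r a m = 0 := by
  refine and_congr_right fun hm => ?_
  have hm : a < m := by linarith [hm.1]
  rw [uB1A_zero hr ha, uB1B_pHatB hc0 hc hm, eq_comm, ← sub_eq_zero,
    payoffAtHat_sub_payoffAtZero hr ha hm, div_eq_zero_iff, or_iff_left (sub_pos.2 hm).ne']

/-! ### Comparison of the regimes with the interior candidate -/

/-- The Cauchy–Schwarz bound on player B's equilibrium bids in terms of its total budget. -/
theorem add_bidLength_le (hc0 : 0 < c) (hc : c < 1) {q d : ℝ} (hq : 0 ≤ q) (hd : 0 ≤ d) :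
    (2 - c) * (q + bidLength (c * d) q) ≤ 2 * (q + d) := by
  have h2c : 0 < 2 - c := by linarith
  -- AM-GM with the radicand split into two factors that coincide exactly when d(2 - 2c) = cq; for q
  -- = x - a, d = m - x this says x = `pHatB`.
  have : √(c * d * (c * d + 2 * q)) ≤ (d * (2 - c) + (c * d + 2 * q) * c / (2 - c)) / 2 := by
    refine Real.sqrt_le_iff.2 ⟨by positivity, ?_⟩
    rw [← sub_nonneg]
    have : ((d * (2 - c) + (c * d + 2 * q) * c / (2 - c)) / 2) ^ 2 - c * d * (c * d + 2 * q)
        = ((d * (2 - c) - (c * d + 2 * q) * c / (2 - c)) / 2) ^ 2 := by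
      field_simp
      ring
    rw [this]
    positivity
  have h := mul_le_mul_of_nonneg_left this h2c.le
  have e : (2 - c) * ((d * (2 - c) + (c * d + 2 * q) * c / (2 - c)) / 2)
      = (d * (2 - c) ^ 2 + (c * d + 2 * q) * c) / 2 := by field_simp
  rw [e] at h
  unfold bidLength
  linarith

theorem add_bidLength_lt (hc0 : 0 < c) (hc : c < 1) {q d : ℝ} (hq : 0 < q) (hd : 0 ≤ d)
    (hne : d * (2 - 2 * c) ≠ c * q) :
    (2 - c) * (q + bidLength (c * d) q) < 2 * (q + d) := by
  have h2c : 0 < 2 - c := by linarith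
  have : √(c * d * (c * d + 2 * q)) < (d * (2 - c) + (c * d + 2 * q) * c / (2 - c)) / 2 := by
    refine (Real.sqrt_lt' (by positivity)).2 ?_
    rw [← sub_pos]
    have : ((d * (2 - c) + (c * d + 2 * q) * c / (2 - c)) / 2) ^ 2 - c * d * (c * d + 2 * q)
        = ((d * (2 - 2 * c) - c * q) / (2 - c)) ^ 2 := by
      field_simp
      ring
    rw [this]
    have := sub_ne_zero.2 hne
    positivity
  have h := mul_lt_mul_of_pos_left this h2c
  have e : (2 - c) * ((d * (2 - c) + (c * d + 2 * q) * c / (2 - c)) / 2)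
      = (d * (2 - c) ^ 2 + (c * d + 2 * q) * c) / 2 := by field_simp
  rw [e] at h
  unfold bidLength
  linarith

theorem pHatB_mem (hc0 : 0 < c) (hc : c < 1) (hm : a < m) :
    a < pHatB (c * m) c a ∧ pHatB (c * m) c a < m := by
  obtain ⟨k, hk, hmk⟩ := sqrt_hat hc0 hc hm
  have h2c : 0 < 2 - c := by linarith
  have hp : pHatB (c * m) c a = m - c * k ^ 2 := by
    rw [pHatB_eq hc0, hmk]
    field_simp
  rw [hp]
  constructor
  · have : 0 < (2 - 2 * c) * k ^ 2 := mul_pos (by linarith) (by positivity)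
    linarith
  · have : 0 < c * k ^ 2 := by positivity
    linarith

/-- At `pHatB` the condition that A be weak reads r ≤ m - a, which is why r + a separates small from
large budgets. -/
theorem uB_pHatB (hc0 : 0 < c) (hc : c < 1) (hr : 0 < r) (hm : r + a ≤ m) :
    uB r (c * m) c a (pHatB (c * m) c a) = payoffAtHat c r a m := by
  have ham : a < m := by linarith
  obtain ⟨h1, h2⟩ := pHatB_mem hc0 hc ham
  obtain ⟨k, hk, hmk⟩ := sqrt_hat hc0 hc ham
  have h2c : 0 < 2 - c := by linarith
  have hp : pHatB (c * m) c a = m - c * k ^ 2 := by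
    rw [pHatB_eq hc0, hmk]
    field_simp
  rw [hp] at h1 h2 ⊢
  have hl : bidLength (c * (m - (m - c * k ^ 2))) (m - c * k ^ 2 - a) = 2 * c * k ^ 2 := by
    rw [bidLength, show c * (m - (m - c * k ^ 2)) * (c * (m - (m - c * k ^ 2)) +
      2 * (m - c * k ^ 2 - a)) = (c * (2 - c) * k ^ 2) ^ 2 by
        linear_combination 2 * c ^ 2 * k ^ 2 * hmk, Real.sqrt_sq (by positivity)]
    ring
  rw [uB_of_weakA hr hc0 h1 h2.le (by rw [hl]; linarith), hl, payoffAtHat, hmk,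
    show m - c * k ^ 2 - a + 2 * c * k ^ 2 = 2 * k ^ 2 by linear_combination hmk]
  field_simp

/-- In the region where player B leaves part of its real-time advantage unused, the interior
candidate is better. -/
theorem strongB_lt_payoffAtHat (hc0 : 0 < c) (hc : c < 1) (hr : 0 < r) (hxa : x ≤ a)
    (h : a - x + bidLength r (a - x) / 2 ≤ c * (m - x)) :
    1 - r / (2 * (c * (m - x) - (a - x))) < payoffAtHat c r a m := by
  have h2 := two_mul_le_bidLength hr.le (sub_nonneg.2 hxa)
  have hD : 0 < c * (m - x) - (a - x) := by linarith
  have hDy : c * (m - x) - (a - x) ≤ c * (m - a) := by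
    nlinarith [mul_nonneg (sub_nonneg.2 hc.le) (sub_nonneg.2 hxa)]
  have hy : 0 < m - a := pos_of_mul_pos_right (hD.trans_le hDy) hc0.le
  have h2c : 0 < 2 - c := by linarith
  -- Uses c(2 - c) = 1 - (1 - c)² < 1.
  have hlt : (2 - c) * (c * (m - x) - (a - x)) < m - a := by
    have := mul_le_mul_of_nonneg_left hDy h2c.le
    have h3 : 0 < (1 - c) ^ 2 * (m - a) := mul_pos (pow_pos (by linarith) 2) hy
    linarith
  unfold payoffAtHat
  rw [sub_lt_sub_iff_left, div_lt_div_iff₀ (by positivity) (by positivity)]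
  nlinarith [mul_lt_mul_of_pos_left hlt hr]

theorem weakA_lt_payoffAtHat (hc0 : 0 < c) (hc : c < 1) (hr : 0 < r) (hax : a < x) (hxm : x ≤ m)
    (hne : x ≠ pHatB (c * m) c a) :
    1 - r / (x - a + bidLength (c * (m - x)) (x - a)) < payoffAtHat c r a m := by
  have h2c : 0 < 2 - c := by linarith
  have hlt := add_bidLength_lt hc0 hc (sub_pos.2 hax) (sub_nonneg.2 hxm) (by
    contrapose! hne
    rw [pHatB_eq hc0]
    field_simp
    linarith)
  have h2 := two_mul_le_bidLength (mul_nonneg hc0.le (sub_nonneg.2 hxm)) (sub_pos.2 hax).le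
  have h3 := mul_nonneg hc0.le (sub_nonneg.2 hxm)
  set S := x - a + bidLength (c * (m - x)) (x - a)
  have hS : 0 < S := by
    simp only [S]
    linarith
  have hm : 0 < m - a := by linarith
  unfold payoffAtHat
  rw [sub_lt_sub_iff_left, div_lt_div_iff₀ (by positivity) hS]
  nlinarith [mul_lt_mul_of_pos_left hlt hr]

theorem weakA_le_payoffAtHat (hc0 : 0 < c) (hc : c < 1) (hr : 0 < r) (hax : a < x) (hxm : x ≤ m) :
    1 - r / (x - a + bidLength (c * (m - x)) (x - a)) ≤ payoffAtHat c r a m := by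
  have h2c : 0 < 2 - c := by linarith
  have hlt := add_bidLength_le hc0 hc (sub_pos.2 hax).le (sub_nonneg.2 hxm)
  have h2 := two_mul_le_bidLength (mul_nonneg hc0.le (sub_nonneg.2 hxm)) (sub_pos.2 hax).le
  have h3 := mul_nonneg hc0.le (sub_nonneg.2 hxm)
  set S := x - a + bidLength (c * (m - x)) (x - a)
  have hS : 0 < S := by
    simp only [S]
    linarith
  have hm : 0 < m - a := by linarith
  unfold payoffAtHat
  rw [sub_le_sub_iff_left, div_le_div_iff₀ (by positivity) hS]
  nlinarith [mul_le_mul_of_nonneg_left hlt hr.le]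

/-- This fixes the sign of the nontrivial factor in the payoff difference computed in
`strongA_le_payoffAtHat`. -/
theorem lt_of_strongA (hc0 : 0 < c) (hc : c < 1) (hax : a < x) (hxm : x ≤ m)
    (h : x - a + bidLength (c * (m - x)) (x - a) / 2 < r) (hm : r + a ≤ m) :
    c * (m - a) < (2 - c) * (r - (x - a)) := by
  have hq := sub_pos.2 hax
  have hd := sub_nonneg.2 hxm
  have hsq := bidLength_sq (mul_nonneg hc0.le hd) hq.le
  have hC := add_bidLength_le hc0 hc hq.le hd
  have h2 := two_mul_le_bidLength (mul_nonneg hc0.le hd) hq.le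
  have hcd := mul_nonneg hc0.le hd
  set l := bidLength (c * (m - x)) (x - a)
  set q := x - a
  set d := m - x
  have hmy : m - a = q + d := by simp only [q, d]; ring
  have hl : 0 ≤ l := by linarith
  -- By the quadratic equation for l this is a positive rescaling of the AM-GM bound when l > 0. If
  -- the claim failed, both factors would be negative.
  have key : (l / 2 - d) * ((2 - c) * (l / 2) - c * (q + d)) ≤ 0 := by
    have e : (q + l) * ((l / 2 - d) * ((2 - c) * (l / 2) - c * (q + d)))
        = l * (q + l / 2) / 2 * ((2 - c) * (q + l) - 2 * (q + d)) := by
      linear_combination (-(q + d) / 2) * hsq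
    have h3 : (q + l) * ((l / 2 - d) * ((2 - c) * (l / 2) - c * (q + d))) ≤ 0 := by
      rw [e]
      exact mul_nonpos_of_nonneg_of_nonpos (by positivity) (by linarith)
    by_contra! h4
    have := mul_pos (show 0 < q + l by linarith) h4
    linarith
  by_contra! h5
  rw [hmy] at h5
  have h6 : l / 2 - d < 0 := by linarith
  have h7 : (2 - c) * (l / 2) - c * (q + d) < 0 := by
    nlinarith [mul_pos (show 0 < 2 - c by linarith) (show 0 < r - q - l / 2 by linarith)]
  have := mul_pos_of_neg_of_neg h6 h7
  linarith

theorem strongA_le_payoffAtHat (hc0 : 0 < c) (hc : c < 1) (hax : a < x)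
    (hxm : x ≤ m) (h : x - a + bidLength (c * (m - x)) (x - a) / 2 < r) (hm : r + a ≤ m) :
    c * (m - x) / (2 * (r - (x - a))) ≤ payoffAtHat c r a m ∧
      (r + a < m → c * (m - x) / (2 * (r - (x - a))) < payoffAtHat c r a m) := by
  have hlt := lt_of_strongA hc0 hc hax hxm h hm
  have hy : 0 < m - a := by linarith
  have hw : 0 < r - (x - a) :=
    pos_of_mul_pos_right ((mul_pos hc0 hy).trans hlt) (by linarith)
  have e : payoffAtHat c r a m - c * (m - x) / (2 * (r - (x - a)))
      = (m - a - r) * ((2 - c) * (r - (x - a)) - c * (m - a)) /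
        (2 * (m - a) * (r - (x - a))) := by
    unfold payoffAtHat
    field_simp
    ring
  constructor
  · rw [← sub_nonneg, e]
    have := sub_nonneg.2 hlt.le
    have : 0 ≤ m - a - r := by linarith
    positivity
  · intro hm'
    rw [← sub_pos, e]
    have := sub_pos.2 hlt
    have : 0 < m - a - r := by linarith
    positivity

/-! ### Pre-allocations up to p_A, and the combined comparisons -/

/-- The bound behind the optimality of zero pre-allocation for small budgets. -/
theorem mul_lt_of_le (hr : 0 < r) (ha : 0 < a) (hm : m ≤ r + a) :
    m * (bidLength r a + 2 * r) < (a + bidLength r a) * bidLength r a := by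
  have h1 := lt_bidLength hr ha
  have hsq := bidLength_sq hr.le ha.le
  nlinarith [mul_le_mul_of_nonneg_right hm (show 0 ≤ bidLength r a + 2 * r by linarith),
    mul_pos hr (sub_pos.2 h1)]

theorem weakB_lt_payoffAtZero (hc0 : 0 < c) (hr : 0 < r) (hx : 0 < x) (hxa : x ≤ a)
    (hm : m ≤ r + a) (hm0 : 0 ≤ m) :
    c * (m - x) / (a - x + bidLength r (a - x)) < payoffAtZero c r a m := by
  have ha : 0 < a := by linarith
  have h1 := lt_bidLength hr ha
  have h2 := two_mul_le_bidLength hr.le (sub_nonneg.2 hxa)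
  have hsq := bidLength_sq hr.le ha.le
  have hsq' := bidLength_sq hr.le (sub_nonneg.2 hxa)
  have key := mul_lt_of_le hr ha hm
  unfold payoffAtZero
  set L := bidLength r a
  set L' := bidLength r (a - x)
  -- Subtracting the two quadratic equations bounds L - L' by 2rx/L, which reduces the claim to
  -- `mul_lt_of_le`.
  have hLL : (L - L') * (L + L' - 2 * r) = 2 * r * x := by linear_combination hsq - hsq'
  have hL : 0 < L := by linarith
  have hLx : L * (L - L') ≤ 2 * r * x := by
    have hpos : 0 ≤ L - L' := by
      by_contra! h
      have := mul_neg_of_neg_of_pos h (show 0 < L + L' - 2 * r by linarith)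
      have := mul_pos hr hx
      linarith
    nlinarith [mul_nonneg hpos (show 0 ≤ L' - 2 * r by linarith)]
  have hfin : (m - x) * (a + L) < m * (a - x + L') := by
    have h3 : m * (L * (L - L')) ≤ m * (2 * r * x) := mul_le_mul_of_nonneg_left hLx hm0
    have h4 := mul_lt_mul_of_pos_left key hx
    have : 0 < L * (m * (a - x + L') - (m - x) * (a + L)) := by nlinarith
    have := pos_of_mul_pos_right this hL.le
    linarith
  rw [div_lt_div_iff₀ (by linarith) (by linarith), mul_assoc, mul_assoc]
  exact mul_lt_mul_of_pos_left hfin hc0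

/-- The square root of an affine function is concave; after squaring, the defect is x(x₁ - x)(s0 -
s1)². -/
theorem bidLength_concave (hr : 0 < r) {x₁ : ℝ} (hx : 0 ≤ x) (hxx : x ≤ x₁) (hxa : x₁ ≤ a) :
    (x₁ - x) * bidLength r a + x * bidLength r (a - x₁) ≤ x₁ * bidLength r (a - x) := by
  have e0 := Real.sq_sqrt (show 0 ≤ r * (r + 2 * a) from mul_nonneg hr.le (by linarith))
  have e1 := Real.sq_sqrt (show 0 ≤ r * (r + 2 * (a - x₁)) from mul_nonneg hr.le (by linarith))
  have e := Real.sq_sqrt (show 0 ≤ r * (r + 2 * (a - x)) from mul_nonneg hr.le (by linarith))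
  have n0 := Real.sqrt_nonneg (r * (r + 2 * a))
  have n1 := Real.sqrt_nonneg (r * (r + 2 * (a - x₁)))
  have n := Real.sqrt_nonneg (r * (r + 2 * (a - x)))
  unfold bidLength
  set s0 := √(r * (r + 2 * a))
  set s1 := √(r * (r + 2 * (a - x₁)))
  set s := √(r * (r + 2 * (a - x)))
  have hd := sub_nonneg.2 hxx
  have hx1 : 0 ≤ x₁ := hx.trans hxx
  have : (x₁ - x) * s0 + x * s1 ≤ x₁ * s := by
    rw [← pow_le_pow_iff_left₀ (by positivity) (by positivity) two_ne_zero, ← sub_nonneg]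
    have : (x₁ * s) ^ 2 - ((x₁ - x) * s0 + x * s1) ^ 2 = x * (x₁ - x) * (s0 - s1) ^ 2 := by
      linear_combination x₁ ^ 2 * e - x₁ * (x₁ - x) * e0 - x₁ * x * e1
    rw [this]
    positivity
  linarith

/-- Quasi-convexity of player B's payoff as long as player B is weak. -/
theorem weakB_quasiconvex (hc0 : 0 < c) (hr : 0 < r) {x₁ : ℝ} (hx : 0 < x) (hxx : x ≤ x₁)
    (hxa : x₁ ≤ a) (hxm : x₁ < m) :
    c * (m - x) / (a - x + bidLength r (a - x)) < payoffAtZero c r a m ∨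
      c * (m - x) / (a - x + bidLength r (a - x)) ≤
        c * (m - x₁) / (a - x₁ + bidLength r (a - x₁)) := by
  have hconc := bidLength_concave hr hx.le hxx hxa
  have h0 := two_mul_le_bidLength hr.le (show 0 ≤ a by linarith)
  have h1 := two_mul_le_bidLength hr.le (sub_nonneg.2 hxa)
  have h2 := two_mul_le_bidLength hr.le (show 0 ≤ a - x by linarith)
  unfold payoffAtZero
  set L0 := bidLength r a
  set L1 := bidLength r (a - x₁)
  set L := bidLength r (a - x)
  by_contra! hcon
  obtain ⟨hA, hB⟩ := hcon
  rw [div_le_div_iff₀ (by linarith) (by linarith), mul_assoc, mul_assoc,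
    mul_le_mul_iff_right₀ hc0] at hA
  rw [div_lt_div_iff₀ (by linarith) (by linarith), mul_assoc, mul_assoc,
    mul_lt_mul_iff_right₀ hc0] at hB
  have hA' := mul_le_mul_of_nonneg_left hA (sub_nonneg.2 hxx)
  have hB' := mul_lt_mul_of_pos_left hB hx
  have hC := mul_le_mul_of_nonneg_left hconc (show 0 ≤ m - x by linarith)
  nlinarith

theorem payoffAtZero_region (hc : c < 1) (hr : 0 < r) (hx : 0 ≤ x)
    (h : c * (m - x) ≤ a - x + bidLength r (a - x) / 2) :
    c * m ≤ a + bidLength r a / 2 := by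
  have := bidLength_mono hr.le (show a - x ≤ a by linarith)
  nlinarith [mul_nonneg (sub_nonneg.2 hc.le) hx]

/-- By quasiconvexity it suffices to treat a right end `x₁`: it is a if B is weak there, and
otherwise a point where B passes from weak to strong. -/
theorem weakB_lt_or_le (hc0 : 0 < c) (hc : c < 1) (hr : 0 < r) (hx : 0 < x) (hxa : x ≤ a)
    (h : c * (m - x) ≤ a - x + bidLength r (a - x) / 2) (hm : r + a ≤ m) :
    c * (m - x) / (a - x + bidLength r (a - x)) < payoffAtZero c r a m ∨
      c * (m - x) / (a - x + bidLength r (a - x)) ≤ payoffAtHat c r a m ∧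
        (r + a < m → c * (m - x) / (a - x + bidLength r (a - x)) < payoffAtHat c r a m) := by
  have hb0 : bidLength r 0 = 2 * r := by
    rw [bidLength, mul_zero, add_zero, Real.sqrt_mul_self hr.le]
    ring
  have hy : 0 < m - a := by linarith
  rcases le_or_gt (c * (m - a)) r with hcy | hcy
  · refine (weakB_quasiconvex hc0 hr hx hxa le_rfl (by linarith)).imp_right fun hle => ?_
    rw [sub_self, hb0, zero_add] at hle
    have e : payoffAtHat c r a m - c * (m - a) / (2 * r)
        = (m - a - r) * (2 * r - c * r - c * (m - a)) / (2 * (m - a) * r) := by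
      unfold payoffAtHat
      field_simp
      ring
    have hpos : 0 < 2 * r - c * r - c * (m - a) := by nlinarith
    constructor
    · refine hle.trans ?_
      rw [← sub_nonneg, e]
      have : 0 ≤ m - a - r := by linarith
      positivity
    · refine fun hm' => hle.trans_lt ?_
      rw [← sub_pos, e]
      have : 0 < m - a - r := by linarith
      positivity
  -- At the crossing point both closed forms equal `uB`, so the strict bound for strong B carries
  -- over.
  · have hcont : ContinuousOn
        (fun t => a - t + bidLength r (a - t) / 2 - c * (m - t)) (Set.Icc x a) := by
      unfold bidLength
      fun_prop
    obtain ⟨x₁, ⟨hx1, hx2⟩, hx3⟩ := intermediate_value_Icc' hxa hcont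
      (show (0 : ℝ) ∈ _ from ⟨by simp only [sub_self, hb0]; linarith, by simpa using h⟩)
    simp only at hx3
    refine (weakB_quasiconvex hc0 hr hx hx1 hx2 (by linarith)).imp_right fun hle => ?_
    have hlt := strongB_lt_payoffAtHat hc0 hc hr hx2
      (show a - x₁ + bidLength r (a - x₁) / 2 ≤ c * (m - x₁) by linarith)
    rw [← uB_of_strongB hr hx2 (by linarith), uB_of_weakB hr hc0 hx2 (by linarith)
      (by linarith)] at hlt
    exact ⟨(hle.trans_lt hlt).le, fun _ => hle.trans_lt hlt⟩

theorem uB_zero_of_weakB (hc0 : 0 < c) (hr : 0 < r) (ha : 0 < a) (hm : 0 ≤ m)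
    (h : c * m ≤ a + bidLength r a / 2) : uB r (c * m) c a 0 = payoffAtZero c r a m := by
  rw [uB_of_weakB hr hc0 ha.le hm (by simpa using h), payoffAtZero, sub_zero, sub_zero]

/-- The first alternative carries c * m ≤ a + L/2 because only then is `payoffAtZero` the true
payoff at 0. Strictness in the second can fail at m = r + a, where the strong-A payoff equals
`payoffAtHat`. -/
theorem uB_lt_or_le_of_large (hc0 : 0 < c) (hc : c < 1) (hr : 0 < r) (hm : r + a ≤ m)
    (hx : 0 < x) (hxm : x ≤ m) (hne : x ≠ pHatB (c * m) c a) :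
    (c * m ≤ a + bidLength r a / 2 ∧ uB r (c * m) c a x < payoffAtZero c r a m) ∨
      uB r (c * m) c a x ≤ payoffAtHat c r a m ∧
        (r + a < m → uB r (c * m) c a x < payoffAtHat c r a m) := by
  rcases le_or_gt x a with hxa | hxa
  · rcases le_total (c * (m - x)) (a - x + bidLength r (a - x) / 2) with h | h
    · rw [uB_of_weakB hr hc0 hxa hxm h]
      exact (weakB_lt_or_le hc0 hc hr hx hxa h hm).imp_left fun h' =>
        ⟨payoffAtZero_region hc hr hx.le h, h'⟩
    · rw [uB_of_strongB hr hxa h]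
      have := strongB_lt_payoffAtHat hc0 hc hr hxa h
      exact Or.inr ⟨this.le, fun _ => this⟩
  · rcases le_or_gt r (x - a + bidLength (c * (m - x)) (x - a) / 2) with h | h
    · rw [uB_of_weakA hr hc0 hxa hxm h]
      have := weakA_lt_payoffAtHat hc0 hc hr hxa hxm hne
      exact Or.inr ⟨this.le, fun _ => this⟩
    · rw [uB_of_strongA hc0 hxa hxm h]
      exact Or.inr (strongA_le_payoffAtHat hc0 hc hxa hxm h hm)

theorem uB_lt_of_small (hc0 : 0 < c) (hc : c < 1) (hr : 0 < r) (ha : 0 < a) (hm : m < r + a)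
    (hx : 0 < x) (hxm : x ≤ m) (hgap : a < m → payoffAtHat c r a m < payoffAtZero c r a m) :
    uB r (c * m) c a x < payoffAtZero c r a m := by
  have hm0 : 0 ≤ m := hx.le.trans hxm
  rcases le_or_gt x a with hxa | hxa
  · have h2 := two_mul_le_bidLength hr.le (sub_nonneg.2 hxa)
    rw [uB_of_weakB hr hc0 hxa hxm
      (by nlinarith [mul_nonneg (sub_nonneg.2 hc.le) (sub_nonneg.2 hxm)])]
    exact weakB_lt_payoffAtZero hc0 hr hx hxa hm.le hm0
  · rcases le_or_gt r (x - a + bidLength (c * (m - x)) (x - a) / 2) with h | h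
    · rw [uB_of_weakA hr hc0 hxa hxm h]
      -- Here `payoffAtHat` serves only as an upper bound; for m < r + a it need not be the payoff
      -- at `pHatB`.
      exact (weakA_le_payoffAtHat hc0 hc hr hxa hxm).trans_lt (hgap (hxa.trans_le hxm))
    · rw [uB_of_strongA hc0 hxa hxm h]
      have h0 := weakB_lt_payoffAtZero hc0 hr ha le_rfl hm.le hm0
      rw [sub_self, bidLength, mul_zero, add_zero, Real.sqrt_mul_self hr.le, zero_add,
        ← two_mul] at h0
      refine lt_of_le_of_lt ?_ h0
      rw [div_le_div_iff₀ (by linarith) (by linarith)]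
      nlinarith [mul_nonneg hc0.le
        (mul_nonneg (sub_nonneg.2 hxa.le) (sub_nonneg.2 hm.le))]

end algebra

/-! ### Best responses on either side of the threshold -/

theorem setOf_isMaxOn_eq_singleton {S : Set ℝ} {u : ℝ → ℝ} {x₀ : ℝ} (h₀ : x₀ ∈ S)
    (h : ∀ x ∈ S, x ≠ x₀ → u x < u x₀) : {x | x ∈ S ∧ IsMaxOn u S x} = {x₀} := by
  ext x
  simp only [Set.mem_ofPred_eq, Set.mem_singleton_iff]
  constructor
  · rintro ⟨hx, hmax⟩
    by_contra hne
    exact (h x hx hne).not_ge (hmax h₀)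
  · rintro rfl
    refine ⟨h₀, fun y hy => ?_⟩
    rcases eq_or_ne y x with rfl | hne
    · exact le_rfl (a := u y)
    · exact (h y hy hne).le

theorem setOf_isMaxOn_eq_pair {S : Set ℝ} {u : ℝ → ℝ} {x₀ x₁ : ℝ} (h₀ : x₀ ∈ S) (h₁ : x₁ ∈ S)
    (heq : u x₀ = u x₁) (h : ∀ x ∈ S, x ≠ x₀ → x ≠ x₁ → u x < u x₀) :
    {x | x ∈ S ∧ IsMaxOn u S x} = {x₀, x₁} := by
  have hmax : ∀ y ∈ S, u y ≤ u x₀ := fun y hy => by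
    by_cases h2 : y = x₀
    · rw [h2]
    by_cases h3 : y = x₁
    · rw [h3, heq]
    exact (h y hy h2 h3).le
  ext x
  simp only [Set.mem_ofPred_eq, Set.mem_insert_iff, Set.mem_singleton_iff]
  constructor
  · rintro ⟨hx, hx2⟩
    by_contra! hne
    exact (h x hx hne.1 hne.2).not_ge (hx2 h₀)
  · rintro (rfl | rfl)
    · exact ⟨h₀, hmax⟩
    · exact ⟨h₁, fun y hy => heq ▸ hmax y hy⟩

section bestResponse

variable {c r a m h : ℝ}

theorem bestResponseB_of_lt (hc0 : 0 < c) (hc : c < 1) (hr : 0 < r) (ha : 0 < a)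
    (hh : h < a + bidLength r a / 2) (hgap : payoffGap c r a h = 0)
    (hm : 0 ≤ m) (hmh : m < h) : bestResponseB r (c * m) c a = {0} := by
  have hcm : c * m ≤ a + bidLength r a / 2 := by nlinarith [mul_nonneg (sub_nonneg.2 hc.le) hm]
  have h0 := uB_zero_of_weakB hc0 hr ha hm hcm
  have hlt : a < m → payoffAtHat c r a m < payoffAtZero c r a m := fun ham => by
    rw [← sub_neg, payoffAtHat_sub_payoffAtZero hr ha ham]
    exact div_neg_of_neg_of_pos (payoffGap_neg_of_lt hc0 hc hr ha hgap hh hmh) (sub_pos.2 ham)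
  unfold bestResponseB
  rw [mul_div_cancel_left₀ m hc0.ne']
  refine setOf_isMaxOn_eq_singleton ⟨le_rfl, hm⟩ fun x hx hx0 => ?_
  have hxpos : 0 < x := lt_of_le_of_ne hx.1 hx0.symm
  rw [h0]
  rcases lt_or_ge m (r + a) with hmr | hmr
  · exact uB_lt_of_small hc0 hc hr ha hmr hxpos hx.2 hlt
  · have hlt := hlt (by linarith)
    by_cases hxh : x = pHatB (c * m) c a
    · rw [hxh, uB_pHatB hc0 hc hr hmr]
      exact hlt
    · rcases uB_lt_or_le_of_large hc0 hc hr hmr hxpos hx.2 hxh with h' | h'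
      · exact h'.2
      · exact h'.1.trans_lt hlt

theorem bestResponseB_of_gt (hc0 : 0 < c) (hc : c < 1) (hr : 0 < r) (ha : 0 < a)
    (hh : r + a < h) (hgap : payoffGap c r a h = 0) (hmh : h < m) :
    bestResponseB r (c * m) c a = {pHatB (c * m) c a} := by
  have ham : a < m := by linarith
  have hmr : r + a < m := by linarith
  obtain ⟨hp1, hp2⟩ := pHatB_mem hc0 hc ham
  have hlt : c * m ≤ a + bidLength r a / 2 → payoffAtZero c r a m < payoffAtHat c r a m :=
    fun hcm => by
      rw [← sub_pos, payoffAtHat_sub_payoffAtZero hr ha ham]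
      exact div_pos (payoffGap_pos_of_lt hc0 hc hr ha hgap hmh hcm) (sub_pos.2 ham)
  unfold bestResponseB
  rw [mul_div_cancel_left₀ m hc0.ne']
  refine setOf_isMaxOn_eq_singleton ⟨by linarith, hp2.le⟩ fun x hx hxh => ?_
  rw [uB_pHatB hc0 hc hr hmr.le]
  rcases hx.1.eq_or_lt with rfl | hxpos
  · rcases le_total (c * m) (a + bidLength r a / 2) with hcm | hcm
    · rw [uB_zero_of_weakB hc0 hr ha (by linarith) hcm]
      exact hlt hcm
    · have hcm : a - 0 + bidLength r (a - 0) / 2 ≤ c * (m - 0) := by simpa using hcm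
      rw [uB_of_strongB hr ha.le hcm]
      exact strongB_lt_payoffAtHat hc0 hc hr ha.le hcm
  · rcases uB_lt_or_le_of_large hc0 hc hr hmr.le hxpos hx.2 hxh with h' | h'
    · exact h'.2.trans (hlt h'.1)
    · exact h'.2 hmr

theorem bestResponseB_of_eq (hc0 : 0 < c) (hc : c < 1) (hr : 0 < r) (ha : 0 < a)
    (hh : m ∈ Set.Ioo (r + a) (a + bidLength r a / 2)) (hgap : payoffGap c r a m = 0) :
    bestResponseB r (c * m) c a = {0, pHatB (c * m) c a} := by
  obtain ⟨hmr, hmL⟩ := hh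
  have ham : a < m := by linarith
  have hm : 0 ≤ m := by linarith
  obtain ⟨hp1, hp2⟩ := pHatB_mem hc0 hc ham
  have hcm : c * m ≤ a + bidLength r a / 2 := by nlinarith [mul_nonneg (sub_nonneg.2 hc.le) hm]
  have h0 := uB_zero_of_weakB hc0 hr ha hm hcm
  have heq : payoffAtHat c r a m = payoffAtZero c r a m := by
    rw [← sub_eq_zero, payoffAtHat_sub_payoffAtZero hr ha ham, hgap, zero_div]
  unfold bestResponseB
  rw [mul_div_cancel_left₀ m hc0.ne']
  refine setOf_isMaxOn_eq_pair ⟨le_rfl, hm⟩ ⟨by linarith, hp2.le⟩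
    (by rw [h0, uB_pHatB hc0 hc hr hmr.le, heq]) fun x hx hx0 hxh => ?_
  rw [h0]
  rcases uB_lt_or_le_of_large hc0 hc hr hmr.le (lt_of_le_of_ne hx.1 hx0.symm) hx.2 hxh
    with h' | h'
  · exact h'.2
  · exact heq ▸ h'.2 hmr

end bestResponse

end GeneralLotto

theorem mainTheorem6 (cB RA pA : ℝ) (hcB0 : 0 < cB) (hcB1 : cB < 1) (hRA : 0 < RA)
    (hpA : 0 < pA) :
    ∃ h : ℝ, GeneralLotto.IsThreshold RA cB pA h ∧
      (∀ m : ℝ, GeneralLotto.IsThreshold RA cB pA m → m = h) ∧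
      ∀ MB : ℝ, 0 ≤ MB →
        (∀ pB ∈ Set.Icc 0 (MB / cB),
          ∃! v : ℝ, GeneralLotto.IsEquilibriumPayoffA (pA - pB) RA (MB - cB * pB) v) ∧
        (MB / cB < h → GeneralLotto.bestResponseB RA MB cB pA = {0}) ∧
        (h < MB / cB →
          GeneralLotto.bestResponseB RA MB cB pA = {GeneralLotto.pHatB MB cB pA}) ∧
        (MB / cB = h →
          GeneralLotto.bestResponseB RA MB cB pA = {0, GeneralLotto.pHatB MB cB pA}) := by

  obtain ⟨h, hmem, hgap⟩ := GeneralLotto.exists_payoffGap_eq_zero hcB0 hcB1 hRA hpA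
  refine ⟨h, (GeneralLotto.isThreshold_iff hcB0 hcB1 hRA hpA).2 ⟨hmem, hgap⟩, fun m hm => ?_,
    fun MB hMB => ?_⟩
  · obtain ⟨hm1, hm2⟩ := (GeneralLotto.isThreshold_iff hcB0 hcB1 hRA hpA).1 hm
    -- Of two distinct roots in the interval, the smaller would have a negative gap by concavity.
    rcases lt_trichotomy m h with hlt | heq | hlt
    · exact absurd hm2
        (GeneralLotto.payoffGap_neg_of_lt hcB0 hcB1 hRA hpA hgap hmem.2 hlt).ne
    · exact heq
    · exact absurd hgap
        (GeneralLotto.payoffGap_neg_of_lt hcB0 hcB1 hRA hpA hm2 hm1.2 hlt).ne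
  · obtain ⟨m, rfl⟩ : ∃ m, MB = cB * m := ⟨MB / cB, by field_simp⟩
    have hm : 0 ≤ m := nonneg_of_mul_nonneg_right hMB hcB0
    rw [mul_div_cancel_left₀ m hcB0.ne']
    refine ⟨fun pB hpB => ?_,
      GeneralLotto.bestResponseB_of_lt hcB0 hcB1 hRA hpA hmem.2 hgap hm,
      GeneralLotto.bestResponseB_of_gt hcB0 hcB1 hRA hpA hmem.1 hgap, ?_⟩
    · refine GeneralLotto.existsUnique_isEquilibriumPayoffA _ hRA ?_
      rw [← mul_sub]
      exact mul_nonneg hcB0.le (sub_nonneg.2 hpB.2)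
    · rintro rfl
      exact GeneralLotto.bestResponseB_of_eq hcB0 hcB1 hRA hpA hmem hgap
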